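/- Let $(R,\mathfrak m)$ be a Noetherian Cohen–Macaulay local ring, let $I=(f_1,\dots,f_n)\subset R$ be an ideal minimally generated by $n$ elements, of height $g=\mathrm{ht}(I)\ge 1$, and let $B=R[y_1,\dots,y_n]$ with its standard grading. Let $K_\bullet=\wedge^\bullet R^n$ be the Koszul complex of $f_1,\dots,f_n$, let $Z_i\subseteq \wedge^iR^n$ be its cycles, and let $\mathcal Z_\bullet$ be the approximation complex $$0\to Z_{n-1}\otimes_RB(-n+1)\to\cdots\to Z_1\otimes_RB(-1)\to Z_0\otimes_RB,\qquad \mathcal Z_i=Z_i\otimes_R B(-i),$$ whose differential is the restriction of the Koszul differential $\partial_{\mathbf y}$ of $K(y_1,\dots,y_n;B)$. For $p,q\ge 0$ let $$\mathfrak D_{p,q}=\wedge^{n-g+2+p+q}R^n\otimes_RB(-n+g-1-p),$$ with vertical differential $\partial_{\mathbf f}:\mathfrak D_{p,q+1}\to\mathfrak D_{p,q}$ and horizontal differential $\partial_{\mathbf y}:\mathfrak D_{p+1,q}\to\mathfrak D_{p,q}$, the differentials of the Koszul complexes $K(f_1,\dots,f_n;B)$ and $K(y_1,\dots,y_n;B)$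 (which anticommute), and let $\mathfrak T_\bullet$ be its total complex, with $\mathfrak T_k=\bigoplus_{p+q=k}\mathfrak D_{p,q}$ and differential $\partial_{\mathbf f}+\partial_{\mathbf y}$. Then the composite $$\mathfrak T_0=\wedge^{n-g+2}R^n\otimes_RB(-n+g-1)\xrightarrow{\ \partial_{\mathbf f}\ }\mathcal Z_{n-g+1}\xrightarrow{\ \partial_{\mathbf y}\ }\mathcal Z_{n-g}$$ splices $\mathfrak T_\bullet$ and the truncation $0\to\mathcal Z_{n-g}\to\cdots\to\mathcal Z_0\to0$ to a complex of $B$-modules, with all differentials homogeneous of degree $0$, $$\mathfrak L_\bullet:\quad 0\to\mathfrak T_{g-2}\to\cdots\to\mathfrak T_1\to\mathfrak T_0\to\mathcal Z_{n-g}\to\cdots\to\mathcal Z_0\to0 .$$ Its modules in the last $g-1$ positions, $\mathfrak L_{n-g+1+k}=\mathfrak T_k$ for $0\le k\le g-2$, are free $B$-modules of finite rank, and $\mathfrak L_i=0$ for $i\ge n$. If $\mathcal Z_\bullet$ is acyclic (exact in all positive degrees), then $\mathfrak L_\bullet$ is acyclic. -/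

import Mathlib

open CategoryTheory TensorProduct

universe u

/-- A local ring is Cohen–Macaulay if its maximal ideal contains a regular sequence whose length
is the Krull dimension of the ring (to be used for Noetherian local rings). -/
def IsCohenMacaulayLocal (R : Type u) [CommRing R] [IsLocalRing R] : Prop :=
  ∃ rs : List R, (∀ r ∈ rs, r ∈ IsLocalRing.maximalIdeal R) ∧
    RingTheory.Sequence.IsRegular R rs ∧ (rs.length : WithBot ℕ∞) = ringKrullDim R

noncomputable section

namespace Approx

section Koszul

variable {R : Type u} [CommRing R] {n : ℕ}

theorem contractLeft_mem (φ : Module.Dual R (Fin n → R)) (i : ℕ) :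
    ∀ x ∈ ⋀[R]^(i + 1) (Fin n → R),
      CliffordAlgebra.contractLeft (Q := (0 : QuadraticForm R (Fin n → R))) φ x ∈
        ⋀[R]^i (Fin n → R) := by
  induction i with
  | zero =>
    intro x hx
    have hx' : x ∈ LinearMap.range (ExteriorAlgebra.ι R (M := Fin n → R)) := by
      simpa [ExteriorAlgebra.exteriorPower] using hx
    obtain ⟨v, rfl⟩ := hx'
    have h := CliffordAlgebra.contractLeft_ι (Q := (0 : QuadraticForm R (Fin n → R))) φ v
    erw [h]
    rw [ExteriorAlgebra.exteriorPower, pow_zero]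
    exact Submodule.algebraMap_mem _
  | succ i ih =>
    intro x hx
    rw [ExteriorAlgebra.exteriorPower, pow_succ'] at hx
    refine Submodule.mul_induction_on hx ?_ ?_
    · rintro _ ⟨v, rfl⟩ b hb
      have h := CliffordAlgebra.contractLeft_ι_mul
        (Q := (0 : QuadraticForm R (Fin n → R))) (d := φ) v b
      erw [h]
      refine Submodule.sub_mem _ (Submodule.smul_mem _ _ hb) ?_
      rw [ExteriorAlgebra.exteriorPower, pow_succ']
      exact Submodule.mul_mem_mul ⟨v, rfl⟩ (ih b hb)
    · intro a b ha hb
      rw [map_add]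
      exact Submodule.add_mem _ ha hb

/-- Contraction with a linear form `φ` on `Rⁿ`:
`v₀ ∧ ⋯ ∧ vᵢ ↦ ∑ₖ (-1)ᵏ φ(vₖ) v₀ ∧ ⋯ ∧ v̂ₖ ∧ ⋯ ∧ vᵢ`. -/
def contract (φ : Module.Dual R (Fin n → R)) (i : ℕ) :
    ⋀[R]^(i + 1) (Fin n → R) →ₗ[R] ⋀[R]^i (Fin n → R) :=
  (CliffordAlgebra.contractLeft (Q := (0 : QuadraticForm R (Fin n → R))) φ).restrict
    (contractLeft_mem φ i)

theorem contract_comm (φ ψ : Module.Dual R (Fin n → R)) (i : ℕ)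
    (x : ⋀[R]^(i + 2) (Fin n → R)) :
    contract φ i (contract ψ (i + 1) x) + contract ψ i (contract φ (i + 1) x) = 0 := by
  apply Subtype.ext
  exact eq_neg_iff_add_eq_zero.mp
    (CliffordAlgebra.contractLeft_comm (Q := (0 : QuadraticForm R (Fin n → R))) φ ψ x.1)

theorem contract_contract (φ : Module.Dual R (Fin n → R)) (i : ℕ)
    (x : ⋀[R]^(i + 2) (Fin n → R)) : contract φ i (contract φ (i + 1) x) = 0 := by
  apply Subtype.ext
  exact CliffordAlgebra.contractLeft_contractLeft (Q := (0 : QuadraticForm R (Fin n → R))) φ x.1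

/-- The differential `∧ⁱ⁺¹Rⁿ → ∧ⁱRⁿ` of the Koszul complex `K_•` of `f₁, …, fₙ`, that is,
contraction with the linear form `e_j ↦ f_j`. -/
def koszulD (f : Fin n → R) (i : ℕ) :
    ⋀[R]^(i + 1) (Fin n → R) →ₗ[R] ⋀[R]^i (Fin n → R) :=
  contract (∑ j, f j • LinearMap.proj j) i

/-- The Koszul cycles `Z_i ⊆ K_i = ∧ⁱRⁿ`. -/
def cycles (f : Fin n → R) : (i : ℕ) → Submodule R (⋀[R]^i (Fin n → R))
  | 0 => ⊤
  | i + 1 => LinearMap.ker (koszulD f i)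

theorem contract_mem_cycles (f : Fin n → R) (φ : Module.Dual R (Fin n → R)) (i : ℕ) :
    ∀ x ∈ cycles f (i + 1), contract φ i x ∈ cycles f i := by
  intro x hx
  cases i with
  | zero => exact Submodule.mem_top
  | succ i =>
    have hx' : koszulD f (i + 1) x = 0 := hx
    change koszulD f i (contract φ (i + 1) x) = 0
    have h := contract_comm (∑ j, f j • LinearMap.proj j) φ i x
    rw [← koszulD, ← koszulD, hx', map_zero, add_zero] at h
    exact h

theorem koszulD_mem_cycles (f : Fin n → R) (i : ℕ) (x : ⋀[R]^(i + 1) (Fin n → R)) :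
    koszulD f i x ∈ cycles f i := by
  cases i with
  | zero => exact Submodule.mem_top
  | succ i => exact contract_contract _ i x

/-- Contraction with the `j`-th coordinate form, restricted to Koszul cycles. -/
def cyclesContract (f : Fin n → R) (j : Fin n) (i : ℕ) : cycles f (i + 1) →ₗ[R] cycles f i :=
  (contract (LinearMap.proj j) i).restrict (contract_mem_cycles f (LinearMap.proj j) i)

theorem cyclesContract_self (f : Fin n → R) (j : Fin n) (i : ℕ) (x : cycles f (i + 2)) :
    cyclesContract f j i (cyclesContract f j (i + 1) x) = 0 := by
  apply Subtype.ext
  exact contract_contract (LinearMap.proj j) i x.1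

theorem cyclesContract_comm (f : Fin n → R) (j k : Fin n) (i : ℕ) (x : cycles f (i + 2)) :
    cyclesContract f k i (cyclesContract f j (i + 1) x) +
      cyclesContract f j i (cyclesContract f k (i + 1) x) = 0 := by
  apply Subtype.ext
  exact contract_comm (LinearMap.proj k) (LinearMap.proj j) i x.1

/-- The Koszul differential, regarded as a map `K_{i+1} → Z_i`. -/
def koszulToCycles (f : Fin n → R) (i : ℕ) : ⋀[R]^(i + 1) (Fin n → R) →ₗ[R] cycles f i :=
  (koszulD f i).codRestrict (cycles f i) (koszulD_mem_cycles f i)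

theorem koszulToCycles_koszulD (f : Fin n → R) (i : ℕ) (x : ⋀[R]^(i + 2) (Fin n → R)) :
    koszulToCycles f i (koszulD f (i + 1) x) = 0 := by
  apply Subtype.ext
  exact contract_contract _ i x

theorem koszulToCycles_contract (f : Fin n → R) (j : Fin n) (i : ℕ)
    (x : ⋀[R]^(i + 2) (Fin n → R)) :
    koszulToCycles f i (contract (LinearMap.proj j) (i + 1) x) +
      cyclesContract f j i (koszulToCycles f (i + 1) x) = 0 := by
  apply Subtype.ext
  exact contract_comm _ (LinearMap.proj j) i x

end Koszul

section Complexes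

variable {R : Type u} [CommRing R] {n : ℕ}

/-- The differential `∂_f` of `K(f₁, …, fₙ; B)`, on `B ⊗ ∧^• Rⁿ` with `B = R[y₁, …, yₙ]`. -/
def dF (f : Fin n → R) (i : ℕ) :
    MvPolynomial (Fin n) R ⊗[R] (⋀[R]^(i + 1) (Fin n → R)) →ₗ[MvPolynomial (Fin n) R]
      MvPolynomial (Fin n) R ⊗[R] (⋀[R]^i (Fin n → R)) :=
  (koszulD f i).baseChange (MvPolynomial (Fin n) R)

/-- The differential `∂_y` of `K(y₁, …, yₙ; B)`, on `B ⊗ ∧^• Rⁿ` with `B = R[y₁, …, yₙ]`. -/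
def dY (R : Type u) [CommRing R] (n i : ℕ) :
    MvPolynomial (Fin n) R ⊗[R] (⋀[R]^(i + 1) (Fin n → R)) →ₗ[MvPolynomial (Fin n) R]
      MvPolynomial (Fin n) R ⊗[R] (⋀[R]^i (Fin n → R)) :=
  ∑ j, (MvPolynomial.X j : MvPolynomial (Fin n) R) •
    (contract (LinearMap.proj j) i).baseChange (MvPolynomial (Fin n) R)

/-- The differential of the approximation complex: the restriction of `∂_y` to `B ⊗ Z_•`. -/
def approxD (f : Fin n → R) (i : ℕ) :
    MvPolynomial (Fin n) R ⊗[R] cycles f (i + 1) →ₗ[MvPolynomial (Fin n) R]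
      MvPolynomial (Fin n) R ⊗[R] cycles f i :=
  ∑ j, (MvPolynomial.X j : MvPolynomial (Fin n) R) •
    (cyclesContract f j i).baseChange (MvPolynomial (Fin n) R)

/-- An alternating double sum vanishes. -/
theorem sum_antisymm {M : Type*} [AddCommMonoid M] (a : Fin n → Fin n → M)
    (h0 : ∀ j, a j j = 0) (h : ∀ j k, a j k + a k j = 0) : ∑ j, ∑ k, a j k = 0 := by
  rw [← Finset.sum_product']
  refine Finset.sum_involution (fun p _ => (p.2, p.1)) ?_ ?_ ?_ ?_
  · intro p _
    exact h p.1 p.2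
  · rintro ⟨j, k⟩ _ hne heq
    have hkj : k = j := congrArg Prod.fst heq
    subst hkj
    exact hne (h0 k)
  · intro p _
    simp
  · intro p _
    rfl

theorem baseChange_ext {B M N : Type*} [CommRing B] [Algebra R B] [AddCommMonoid M] [Module R M]
    [AddCommMonoid N] [Module B N] {u v : B ⊗[R] M →ₗ[B] N}
    (h : ∀ m, u (1 ⊗ₜ m) = v (1 ⊗ₜ m)) : u = v := by
  refine LinearMap.ext fun x => ?_
  induction x with
  | zero => rw [map_zero, map_zero]
  | add x y hx hy => rw [map_add, map_add, hx, hy]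
  | tmul b m =>
    have hb : b ⊗ₜ[R] m = b • ((1 : B) ⊗ₜ[R] m) := by
      rw [TensorProduct.smul_tmul', smul_eq_mul, mul_one]
    rw [hb, map_smul, map_smul, h]

theorem baseChange_comp_zero {M₂ M₁ M₀ : Type*} [AddCommMonoid M₂] [Module R M₂]
    [AddCommMonoid M₁] [Module R M₁] [AddCommMonoid M₀] [Module R M₀]
    (a : M₂ →ₗ[R] M₁) (b : M₁ →ₗ[R] M₀) (h : ∀ x, b (a x) = 0) :
    b.baseChange (MvPolynomial (Fin n) R) ∘ₗ a.baseChange (MvPolynomial (Fin n) R) = 0 := by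
  refine baseChange_ext fun x => ?_
  simp [h]

theorem sum_X_comp_zero {M₂ M₁ M₀ : Type*} [AddCommMonoid M₂] [Module R M₂]
    [AddCommMonoid M₁] [Module R M₁] [AddCommMonoid M₀] [Module R M₀]
    (a : Fin n → M₂ →ₗ[R] M₁) (b : Fin n → M₁ →ₗ[R] M₀) (h0 : ∀ j x, b j (a j x) = 0)
    (h : ∀ j k x, b k (a j x) + b j (a k x) = 0) :
    (∑ j, (MvPolynomial.X j : MvPolynomial (Fin n) R) •
        (b j).baseChange (MvPolynomial (Fin n) R)) ∘ₗ
      (∑ j, (MvPolynomial.X j : MvPolynomial (Fin n) R) •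
        (a j).baseChange (MvPolynomial (Fin n) R)) = 0 := by
  refine baseChange_ext fun x => ?_
  simp only [LinearMap.comp_apply, LinearMap.sum_apply, LinearMap.smul_apply,
    LinearMap.baseChange_tmul, map_sum, map_smul, LinearMap.zero_apply]
  simp only [Finset.smul_sum]
  refine sum_antisymm _ (fun j => ?_) (fun j k => ?_)
  · rw [h0, TensorProduct.tmul_zero, smul_zero, smul_zero]
  · rw [smul_comm (MvPolynomial.X k : MvPolynomial (Fin n) R), ← smul_add, ← smul_add,
      ← TensorProduct.tmul_add, h, TensorProduct.tmul_zero, smul_zero, smul_zero]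

theorem sum_X_anticomm {M₂ M₁ M₁' M₀ : Type*} [AddCommMonoid M₂] [Module R M₂]
    [AddCommMonoid M₁] [Module R M₁] [AddCommMonoid M₁'] [Module R M₁']
    [AddCommMonoid M₀] [Module R M₀]
    (a : Fin n → M₂ →ₗ[R] M₁) (b : Fin n → M₁' →ₗ[R] M₀) (p : M₂ →ₗ[R] M₁') (q : M₁ →ₗ[R] M₀)
    (h : ∀ j x, q (a j x) + b j (p x) = 0) :
    q.baseChange (MvPolynomial (Fin n) R) ∘ₗ
        (∑ j, (MvPolynomial.X j : MvPolynomial (Fin n) R) •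
          (a j).baseChange (MvPolynomial (Fin n) R)) +
      (∑ j, (MvPolynomial.X j : MvPolynomial (Fin n) R) •
          (b j).baseChange (MvPolynomial (Fin n) R)) ∘ₗ
        p.baseChange (MvPolynomial (Fin n) R) = 0 := by
  refine baseChange_ext fun x => ?_
  simp only [LinearMap.comp_apply, LinearMap.sum_apply, LinearMap.smul_apply,
    LinearMap.baseChange_tmul, map_sum, map_smul, LinearMap.add_apply, LinearMap.zero_apply]
  rw [← Finset.sum_add_distrib]
  refine Finset.sum_eq_zero fun j _ => ?_
  rw [← smul_add, ← TensorProduct.tmul_add, h, TensorProduct.tmul_zero, smul_zero]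

theorem dF_dF (f : Fin n → R) (i : ℕ) : dF f i ∘ₗ dF f (i + 1) = 0 :=
  baseChange_comp_zero _ _ fun x => contract_contract _ i x

theorem dY_dY (i : ℕ) : dY R n i ∘ₗ dY R n (i + 1) = 0 :=
  sum_X_comp_zero _ _ (fun _ x => contract_contract _ i x) (fun _ _ x => contract_comm _ _ i x)

theorem dF_dY (f : Fin n → R) (i : ℕ) :
    dF f i ∘ₗ dY R n (i + 1) + dY R n i ∘ₗ dF f (i + 1) = 0 :=
  sum_X_anticomm _ _ _ _ fun _ x => contract_comm _ _ i x

theorem approxD_approxD (f : Fin n → R) (i : ℕ) : approxD f i ∘ₗ approxD f (i + 1) = 0 :=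
  sum_X_comp_zero _ _ (fun j x => cyclesContract_self f j i x)
    (fun j k x => cyclesContract_comm f j k i x)

/-- The approximation complex `𝒵_•`, with `𝒵_i = Z_i ⊗ B(-i)`. -/
def approxComplex (f : Fin n → R) : ChainComplex (ModuleCat.{u} (MvPolynomial (Fin n) R)) ℕ :=
  ChainComplex.of
    (fun i => ModuleCat.of (MvPolynomial (Fin n) R)
      (MvPolynomial (Fin n) R ⊗[R] cycles f i))
    (fun i => ModuleCat.ofHom (approxD f i))
    (fun i => by rw [← ModuleCat.ofHom_comp, approxD_approxD]; rfl)

theorem approxComplex_d (f : Fin n → R) (i : ℕ) :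
    (approxComplex f).d (i + 1) i = ModuleCat.ofHom (approxD f i) :=
  ChainComplex.of_d (fun i => ModuleCat.of (MvPolynomial (Fin n) R)
    (MvPolynomial (Fin n) R ⊗[R] cycles f i)) (fun i => ModuleCat.ofHom (approxD f i)) i

/-- The double complex `𝔇_{p,q} = ∧^{c+2+p+q}Rⁿ ⊗ B` (`p, q ≥ 0`) has the vertical differential
`∂_f : 𝔇_{p,q+1} → 𝔇_{p,q}` and the horizontal differential `∂_y : 𝔇_{p+1,q} → 𝔇_{p,q}`. The
underlying module of `𝔇_{p,q}` only depends on `k = p + q`, and an element of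
`Tot_k = ⨁_{p+q=k} 𝔇_{p,q}` is the family of its components in `𝔇_{p,k-p}` for `0 ≤ p ≤ k`.
This is the differential `∂_f + ∂_y` of the total complex. -/
def totalD (f : Fin n → R) (c k : ℕ) :
    (Fin (k + 2) → MvPolynomial (Fin n) R ⊗[R] (⋀[R]^(c + 2 + (k + 1)) (Fin n → R)))
      →ₗ[MvPolynomial (Fin n) R]
    (Fin (k + 1) → MvPolynomial (Fin n) R ⊗[R] (⋀[R]^(c + 2 + k) (Fin n → R))) :=
  LinearMap.pi fun p =>
    dF f (c + 2 + k) ∘ₗ LinearMap.proj p.castSucc + dY R n (c + 2 + k) ∘ₗ LinearMap.proj p.succ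

theorem totalD_totalD (f : Fin n → R) (c k : ℕ) : totalD f c k ∘ₗ totalD f c (k + 1) = 0 := by
  refine LinearMap.ext fun x => funext fun p => ?_
  have h1 := fun z => LinearMap.congr_fun (dF_dF f (c + 2 + k)) z
  have h2 := fun z => LinearMap.congr_fun (dY_dY (R := R) (n := n) (c + 2 + k)) z
  have h3 := fun z => LinearMap.congr_fun (dF_dY f (c + 2 + k)) z
  simp only [LinearMap.comp_apply, LinearMap.add_apply, LinearMap.zero_apply] at h1 h2 h3
  change dF f (c + 2 + k) (dF f (c + 2 + (k + 1)) (x p.castSucc.castSucc) +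
      dY R n (c + 2 + (k + 1)) (x p.castSucc.succ)) +
    dY R n (c + 2 + k) (dF f (c + 2 + (k + 1)) (x p.succ.castSucc) +
      dY R n (c + 2 + (k + 1)) (x p.succ.succ)) = 0
  rw [map_add, map_add]
  erw [h1, h2]
  rw [zero_add, add_zero, Fin.succ_castSucc]
  exact h3 _

/-- The total complex `𝔗_•` of the double complex `𝔇_{p,q} = ∧^{c+2+p+q}Rⁿ ⊗ B`, `p, q ≥ 0`. -/
def totalComplex (f : Fin n → R) (c : ℕ) :
    ChainComplex (ModuleCat.{u} (MvPolynomial (Fin n) R)) ℕ :=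
  ChainComplex.of
    (fun k => ModuleCat.of (MvPolynomial (Fin n) R)
      (Fin (k + 1) → MvPolynomial (Fin n) R ⊗[R] (⋀[R]^(c + 2 + k) (Fin n → R))))
    (fun k => ModuleCat.ofHom (totalD f c k))
    (fun k => by rw [← ModuleCat.ofHom_comp, totalD_totalD]; rfl)

theorem totalComplex_d (f : Fin n → R) (c k : ℕ) :
    (totalComplex f c).d (k + 1) k = ModuleCat.ofHom (totalD f c k) :=
  ChainComplex.of_d (fun k => ModuleCat.of (MvPolynomial (Fin n) R)
    (Fin (k + 1) → MvPolynomial (Fin n) R ⊗[R] (⋀[R]^(c + 2 + k) (Fin n → R))))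
    (fun k => ModuleCat.ofHom (totalD f c k)) k

/-- The splicing map `𝔗_0 = ∧^{c+2}Rⁿ ⊗ B → 𝒵_c`: the composite of
`∂_f : ∧^{c+2}Rⁿ ⊗ B → Z_{c+1} ⊗ B = 𝒵_{c+1}` and the differential `∂_y : 𝒵_{c+1} → 𝒵_c`. -/
def spliceMap (f : Fin n → R) (c : ℕ) :
    (Fin 1 → MvPolynomial (Fin n) R ⊗[R] (⋀[R]^(c + 2) (Fin n → R)))
      →ₗ[MvPolynomial (Fin n) R] MvPolynomial (Fin n) R ⊗[R] cycles f c :=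
  approxD f c ∘ₗ (koszulToCycles f (c + 1)).baseChange (MvPolynomial (Fin n) R) ∘ₗ
    LinearMap.proj 0

theorem totalD_spliceMap (f : Fin n → R) (c : ℕ) : spliceMap f c ∘ₗ totalD f c 0 = 0 := by
  have h1 : (koszulToCycles f (c + 1)).baseChange (MvPolynomial (Fin n) R) ∘ₗ dF f (c + 2) = 0 :=
    baseChange_comp_zero _ _ fun x => koszulToCycles_koszulD f (c + 1) x
  have h2 : (koszulToCycles f (c + 1)).baseChange (MvPolynomial (Fin n) R) ∘ₗ dY R n (c + 2) +
      approxD f (c + 1) ∘ₗ (koszulToCycles f (c + 2)).baseChange (MvPolynomial (Fin n) R) = 0 :=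
    sum_X_anticomm _ _ _ _ fun j x => koszulToCycles_contract f j (c + 1) x
  refine LinearMap.ext fun x => ?_
  have h1' := fun z => LinearMap.congr_fun h1 z
  have h2' := fun z => LinearMap.congr_fun h2 z
  have h3' := fun z => LinearMap.congr_fun (approxD_approxD f c) z
  simp only [LinearMap.comp_apply, LinearMap.add_apply, LinearMap.zero_apply] at h1' h2' h3'
  have h4 := congrArg (approxD f c) (h2' (x 1))
  rw [map_add, map_zero] at h4
  erw [h3', add_zero] at h4
  change approxD f c ((koszulToCycles f (c + 1)).baseChange (MvPolynomial (Fin n) R)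
    (dF f (c + 2) (x 0) + dY R n (c + 2) (x 1))) = 0
  rw [map_add]
  erw [h1', zero_add]
  exact h4

/-- The splicing map as a morphism `𝔗_0 ⟶ 𝒵_c`. -/
def connect (f : Fin n → R) (c : ℕ) : (totalComplex f c).X 0 ⟶ (approxComplex f).X c :=
  ModuleCat.ofHom (spliceMap f c)

theorem d_connect (f : Fin n → R) (c : ℕ) : (totalComplex f c).d 1 0 ≫ connect f c = 0 := by
  rw [totalComplex_d]
  exact (ModuleCat.ofHom_comp _ _).symm.trans (by rw [totalD_spliceMap]; rfl)

theorem connect_d (f : Fin n → R) (c j : ℕ) : connect f c ≫ (approxComplex f).d c j = 0 := by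
  let e : (totalComplex f c).X 0 ⟶ (approxComplex f).X (c + 1) :=
    ModuleCat.ofHom ((koszulToCycles f (c + 1)).baseChange (MvPolynomial (Fin n) R) ∘ₗ
      LinearMap.proj (0 : Fin 1))
  have h : connect f c = e ≫ (approxComplex f).d (c + 1) c := by
    rw [approxComplex_d]; rfl
  rw [h, Category.assoc, HomologicalComplex.d_comp_d, Limits.comp_zero]

end Complexes

/-- Given a chain complex `A`, a chain complex `T` and `s : T_0 ⟶ A_c` whose composites with the
neighbouring differentials vanish, the spliced complex
`⋯ → T_1 → T_0 → A_c → A_{c-1} → ⋯ → A_0`, with `A_0` in degree `0`. It is obtained by putting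
`A_c`, then `A_{c-1}`, …, then `A_0` at the end of `T`. -/
def splice {C : Type*} [Category C] [Limits.HasZeroMorphisms C] (A : ChainComplex C ℕ) :
    (c : ℕ) → (T : ChainComplex C ℕ) → (s : T.X 0 ⟶ A.X c) → T.d 1 0 ≫ s = 0 →
      (∀ j, s ≫ A.d c j = 0) → ChainComplex C ℕ
  | 0, T, s, h, _ => ChainComplex.augment T s h
  | c + 1, T, s, h, h' =>
    splice A c (ChainComplex.augment T s h) (A.d (c + 1) c) (h' c)
      (fun _ => A.d_comp_d _ _ _)

/-- The complex `𝔏_• : ⋯ → 𝔗_1 → 𝔗_0 → 𝒵_c → ⋯ → 𝒵_0 → 0`, with `𝒵_0` in degree `0`. -/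
def splicedComplex {R : Type u} [CommRing R] {n : ℕ} (f : Fin n → R) (c : ℕ) :
    ChainComplex (ModuleCat.{u} (MvPolynomial (Fin n) R)) ℕ :=
  splice (approxComplex f) c (totalComplex f c) (connect f c) (d_connect f c) (connect_d f c)

/-- The degree `ν` part of the graded `B`-module `B(-a) ⊗_R M`, where `B = R[y₁, …, yₙ]` has its
standard grading and `M` is an `R`-module: it is spanned by the `b ⊗ m` with `b` homogeneous of
degree `ν - a` (and it is zero if `ν < a`). -/
def twistPart {R : Type u} [CommRing R] (n : ℕ) (M : Type*) [AddCommGroup M] [Module R M]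
    (a ν : ℕ) : Submodule R (MvPolynomial (Fin n) R ⊗[R] M) :=
  Submodule.span R {x | ∃ (e : ℕ) (b : MvPolynomial (Fin n) R) (m : M),
    e + a = ν ∧ b.IsHomogeneous e ∧ x = b ⊗ₜ[R] m}

end Approx

end

namespace Approx

/-! ### Depth sensitivity of the Koszul complex -/

section KoszulHomotopy

variable {R : Type u} [CommRing R] {n : ℕ}

/-! Put `c = n - g`. The ring being Cohen–Macaulay, the ideal contains a regular sequence of length
`g`, so the Koszul complex is exact in degrees above `c`
(`koszulExactAbove_of_isCohenMacaulayLocal`). As `B` is flat over `R`, the column `𝔇_{p,•}` is then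
exact away from its bottom term, and the cokernel at the bottom is `Z_{c+1+p} ⊗ B`, identified by
`∂_f`. The columns thus resolve the terms `𝒵_{c+1}, 𝒵_{c+2}, …` cut off by the truncation, and `𝔗`
has the homology of that upper part of `𝒵`. If `𝒵` is acyclic, this homology vanishes in positive
degrees, and in degree `0` it is the image of `𝒵_{c+1}` in `𝒵_c`, which is just what the splicing
map has to supply.

The comparison is carried out as an explicit chase. `exists_lift_of_columns_exact` lifts a family
along the columns, starting from its last component. `exists_lift_of_approxD_exact` first uses
exactness of `𝒵` to correct that component so that the column lift applies.

The regular sequence is found through vanishing of `Ext` from the residue field, which passes to `M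
/ xM` with the bound lowered by one. A bound on `dim R / p` at associated primes shows that the
ideal cannot consist of zero divisors before `g` steps. The description of the spliced complex
follows the recursion defining `splice`, and homogeneity is a count of degrees. -/

theorem ι_mul_mem_exteriorPower (v : Fin n → R) (i : ℕ) :
    ∀ x ∈ ⋀[R]^i (Fin n → R),
      LinearMap.mulLeft R (ExteriorAlgebra.ι R v) x ∈ ⋀[R]^(i + 1) (Fin n → R) := by
  intro x hx
  rw [LinearMap.mulLeft_apply, ExteriorAlgebra.exteriorPower, pow_succ']
  exact Submodule.mul_mem_mul ⟨v, rfl⟩ hx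

/-- Left exterior multiplication `x ↦ v ∧ x`. -/
noncomputable def wedge (v : Fin n → R) (i : ℕ) :
    ⋀[R]^i (Fin n → R) →ₗ[R] ⋀[R]^(i + 1) (Fin n → R) :=
  (LinearMap.mulLeft R (ExteriorAlgebra.ι R v)).restrict (ι_mul_mem_exteriorPower v i)

/-- Contraction is an antiderivation: `φ ⌟ (v ∧ x) = φ(v) x - v ∧ (φ ⌟ x)`. -/
theorem contract_wedge (φ : Module.Dual R (Fin n → R)) (v : Fin n → R) (i : ℕ) :
    contract φ (i + 1) ∘ₗ wedge v (i + 1) + wedge v i ∘ₗ contract φ i =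
      φ v • LinearMap.id := by
  refine LinearMap.ext fun x => Subtype.ext ?_
  have h := CliffordAlgebra.contractLeft_ι_mul
    (Q := (0 : QuadraticForm R (Fin n → R))) (d := φ) v x.1
  exact (congrArg (· + ExteriorAlgebra.ι R v *
    CliffordAlgebra.contractLeft (Q := (0 : QuadraticForm R (Fin n → R))) φ x.1) h).trans
      (sub_add_cancel _ _)

/-- A linear combination of the `fⱼ` acts on the Koszul complex by a null-homotopic map. -/
theorem koszulD_wedge (f v : Fin n → R) (i : ℕ) :
    koszulD f (i + 1) ∘ₗ wedge v (i + 1) + wedge v i ∘ₗ koszulD f i =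
      (∑ j, f j * v j) • LinearMap.id := by
  rw [koszulD, koszulD, contract_wedge]
  simp

theorem exteriorPower_subsingleton [Nontrivial R] {i : ℕ} (hi : n < i) :
    Subsingleton (⋀[R]^i (Fin n → R)) := by
  rw [← Module.finrank_eq_zero_iff_of_free R, exteriorPower.finrank_eq, Module.finrank_fin_fun,
    Nat.choose_eq_zero_of_lt hi]

/-- Induction on the sequence, one degree of exactness being gained per element. Coefficients in an
arbitrary `M` are needed to pass to `M / xM`. The homotopy for `x` replaces the long exact sequence:
a cycle `z` satisfies `x z = ∂(v ∧ z)`, and exactness over `M / xM` one degree higher allows `x` to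
be cancelled. -/
theorem lTensor_koszulD_exact [Nontrivial R] (f : Fin n → R) (rs : List R)
    (hmem : ∀ r ∈ rs, r ∈ Ideal.span (Set.range f)) {M : Type u} [AddCommGroup M] [Module R M]
    (hreg : RingTheory.Sequence.IsWeaklyRegular M rs) {i : ℕ} (hi : n < i + 1 + rs.length) :
    Function.Exact ((koszulD f (i + 1)).lTensor M) ((koszulD f i).lTensor M) := by
  induction rs generalizing M i with
  | nil =>
    -- With no regular element left, the bound says that the degree exceeds `n`, where the exterior
    -- power vanishes.
    have := exteriorPower_subsingleton (R := R) (n := n) (i := i + 1) (by simpa using hi)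
    exact fun y => ⟨fun _ => ⟨0, Subsingleton.elim _ _⟩, fun _ => by
      rw [Subsingleton.elim y 0, map_zero]⟩
  | cons x rs ih =>
    rw [RingTheory.Sequence.isWeaklyRegular_cons_iff] at hreg
    obtain ⟨hx, hrs⟩ := hreg
    have hmem' : ∀ r ∈ rs, r ∈ Ideal.span (Set.range f) := fun r hr => hmem r (by simp [hr])
    have hlen : n < i + 1 + 1 + rs.length := by simp only [List.length_cons] at hi; omega
    have hex := ih hmem' hrs (i := i + 1) hlen
    obtain ⟨v, hv⟩ := (Ideal.mem_span_range_iff_exists_fun).mp (hmem x (by simp))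
    have hv' : ∑ j, f j * v j = x := by simp_rw [mul_comm (f _)]; exact hv
    intro z
    constructor
    · intro hz
      let q : M →ₗ[R] QuotSMulTop x M := Submodule.mkQ _
      have hq : Function.Surjective q := Submodule.mkQ_surjective _
      have hxq : Function.Exact (LinearMap.lsmul R M x) q := LinearMap.exact_lsmul_mkQ_smul_top M x
      -- Modulo `x` the element `w = v ∧ z` is a cycle, hence a boundary, so `w = ∂t + x s`. Then `x
      -- ∂s = ∂w = x z`, and `s` is the required preimage of `z`.
      set w := (wedge v (i + 1)).lTensor M z with hw
      have hdw : (koszulD f (i + 1)).lTensor M w = x • z := by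
        have h := congrArg (fun φ => φ.lTensor M z) (koszulD_wedge f v i)
        simp only [LinearMap.lTensor_add, LinearMap.lTensor_comp, LinearMap.add_apply,
          LinearMap.comp_apply, hz, map_zero, add_zero, LinearMap.lTensor_smul,
          LinearMap.lTensor_id, LinearMap.smul_apply, LinearMap.id_apply, hv'] at h
        exact h
      have hcomm : ∀ k (y : M ⊗[R] ⋀[R]^(k + 1) (Fin n → R)),
          (koszulD f k).lTensor (QuotSMulTop x M) (q.rTensor _ y) =
            q.rTensor _ ((koszulD f k).lTensor M y) := fun k y => by
        rw [← LinearMap.comp_apply, LinearMap.lTensor_comp_rTensor, ← LinearMap.comp_apply,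
          LinearMap.rTensor_comp_lTensor]
      have hkill : ∀ k (y : M ⊗[R] ⋀[R]^k (Fin n → R)), q.rTensor _ (x • y) = 0 := by
        intro k y
        have : x • y = (LinearMap.lsmul R M x).rTensor _ y := by
          rw [show LinearMap.lsmul R M x = x • LinearMap.id from rfl, LinearMap.rTensor_smul]
          simp
        rw [this]
        exact (rTensor_exact _ hxq hq).apply_apply_eq_zero y
      have h1 : (koszulD f (i + 1)).lTensor (QuotSMulTop x M) (q.rTensor _ w) = 0 := by
        rw [hcomm, hdw, hkill]
      obtain ⟨v', hv'⟩ := (hex _).mp h1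
      obtain ⟨t, rfl⟩ := LinearMap.rTensor_surjective _ hq v'
      have h2 : q.rTensor _ (w - (koszulD f (i + 1 + 1)).lTensor M t) = 0 := by
        rw [map_sub, ← hcomm, hv', sub_self]
      obtain ⟨s, hs⟩ := (rTensor_exact _ hxq hq _).mp h2
      have hs' : x • s = w - (koszulD f (i + 1 + 1)).lTensor M t := by
        rw [← hs, show LinearMap.lsmul R M x = x • LinearMap.id from rfl, LinearMap.rTensor_smul]
        simp
      refine ⟨s, ?_⟩
      have hdd : (koszulD f (i + 1)).lTensor M ((koszulD f (i + 1 + 1)).lTensor M t) = 0 := by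
        rw [← LinearMap.comp_apply, ← LinearMap.lTensor_comp,
          show koszulD f (i + 1) ∘ₗ koszulD f (i + 1 + 1) = 0 from
            LinearMap.ext fun y => contract_contract _ _ y]
        simp
      have hreg : IsSMulRegular (M ⊗[R] ⋀[R]^(i + 1) (Fin n → R)) x :=
        IsSMulRegular.rTensor _ hx
      apply hreg
      change x • _ = x • _
      rw [← map_smul, hs', map_sub, hdd, sub_zero, hdw]
    · rintro ⟨y, rfl⟩
      rw [← LinearMap.comp_apply, ← LinearMap.lTensor_comp,
        show koszulD f i ∘ₗ koszulD f (i + 1) = 0 from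
          LinearMap.ext fun y => contract_contract _ _ y]
      simp

end KoszulHomotopy

end Approx

/-! ### Regular sequences of length the height in Cohen–Macaulay local rings -/

section Grade

open IsLocalRing RingTheory.Sequence Abelian
open scoped Pointwise

/-- Long exact `Ext` sequence of `0 → M → M → M / xM → 0`: the group in question lies between two
that vanish. -/
theorem subsingleton_ext_quotSMulTop {R : Type u} [CommRing R] (N M : ModuleCat.{u} R) {x : R}
    (hx : IsSMulRegular M x) {d : ℕ} (h : ∀ i < d + 1, Subsingleton (Ext N M i)) :
    ∀ i < d, Subsingleton (Ext N (ModuleCat.of R (QuotSMulTop x M)) i) := by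
  intro i hi
  have zero1 := AddCommGrpCat.isZero_of_iff_subsingleton.mpr (h i (by omega))
  have zero2 := AddCommGrpCat.isZero_of_iff_subsingleton.mpr (h (i + 1) (by omega))
  exact AddCommGrpCat.subsingleton_of_isZero <| ShortComplex.Exact.isZero_of_both_zeros
    ((Ext.covariant_sequence_exact₃' N hx.smulShortComplex_shortExact) i (i + 1) rfl)
    (zero1.eq_zero_of_src _) (zero2.eq_zero_of_tgt _)

variable {R : Type u} [CommRing R] [IsNoetherianRing R] [IsLocalRing R]

/-- If `x` is `M`-regular and `p` is associated to `M`, then some associated prime of `M / xM`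
contains `p` and `x`. -/
theorem exists_isAssociatedPrime_quotSMulTop {M : Type u} [AddCommGroup M] [Module R M]
    [Module.Finite R M] {x : R} (hxm : x ∈ maximalIdeal R) (hx : IsSMulRegular M x)
    {p : Ideal R} (hp : IsAssociatedPrime p M) :
    x ∉ p ∧ ∃ q : Ideal R, IsAssociatedPrime q (QuotSMulTop x M) ∧ p ≤ q ∧ x ∈ q := by
  obtain ⟨hpp, m, hm⟩ := (isAssociatedPrime_iff).mp hp
  have hmem : ∀ r, r ∈ p ↔ r • m = 0 := fun r => by
    rw [hm, Submodule.mem_colon_singleton, Submodule.mem_bot]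
  have hm0 : m ≠ 0 := fun h => hpp.ne_top ((Ideal.eq_top_iff_one _).mpr ((hmem 1).mpr (by simp [h])))
  refine ⟨fun hxp => hm0 (hx.right_eq_zero_of_smul ((hmem x).mp hxp)), ?_⟩
  let N : Submodule R M := Submodule.torsionBySet R M p
  have hN : ∀ z, z ∈ N ↔ ∀ r ∈ p, r • z = 0 := fun z => by
    rw [Submodule.mem_torsionBySet_iff]; simp
  have hmN : m ∈ N := (hN m).mpr fun r hr => (hmem r).mp hr
  -- If every `z ∈ N` were `x y`, regularity of `x` would put `y` in `N`; then `N = xN`, and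
  -- Nakayama would give `N = 0`, although `m ∈ N`.
  have hex : ∃ z ∈ N, z ∉ x • (⊤ : Submodule R M) := by
    by_contra! hcon
    have hle : N ≤ Ideal.span {x} • N := by
      intro z hz
      obtain ⟨y, -, rfl⟩ := (Submodule.mem_smul_pointwise_iff_exists _ _ _).mp (hcon z hz)
      refine Submodule.smul_mem_smul (Ideal.mem_span_singleton_self x) ((hN y).mpr fun r hr => ?_)
      refine hx.right_eq_zero_of_smul ?_
      rw [smul_comm]
      exact (hN _).mp hz r hr
    have hbot := Submodule.eq_bot_of_le_smul_of_le_jacobson_bot (Ideal.span {x}) N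
      (IsNoetherian.noetherian N) hle (by
        rw [IsLocalRing.jacobson_eq_maximalIdeal ⊥ bot_ne_top, Ideal.span_singleton_le_iff_mem]
        exact hxm)
    exact hm0 (by simpa [hbot] using hmN)
  obtain ⟨z, hzN, hz⟩ := hex
  let w : QuotSMulTop x M := Submodule.Quotient.mk z
  have hw : w ≠ 0 := fun h => hz ((Submodule.Quotient.mk_eq_zero _).mp h)
  -- Both `p` and `x` annihilate the nonzero class `w`, so an associated prime above its annihilator
  -- contains them.
  obtain ⟨q, hq, hle⟩ := exists_le_isAssociatedPrime_of_isNoetherianRing R w hw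
  refine ⟨q, hq, fun r hr => hle ?_, hle ?_⟩
  · rw [Submodule.mem_colon_singleton, Submodule.mem_bot, ← Submodule.Quotient.mk_smul,
      (hN z).mp hzN r hr, Submodule.Quotient.mk_zero]
  · rw [Submodule.mem_colon_singleton, Submodule.mem_bot, ← Submodule.Quotient.mk_smul,
      Submodule.Quotient.mk_eq_zero]
    exact Submodule.smul_mem_pointwise_smul _ _ _ Submodule.mem_top

/-- The length of a regular sequence on `M` is at most `dim R / p` for `p` associated to `M`. -/
theorem length_le_coheight_of_isAssociatedPrime {M : Type u} [AddCommGroup M] [Module R M]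
    [Module.Finite R M] (rs : List R) (hmem : ∀ r ∈ rs, r ∈ maximalIdeal R)
    (hreg : IsWeaklyRegular M rs) {p : PrimeSpectrum R} (hp : IsAssociatedPrime p.asIdeal M) :
    (rs.length : ℕ∞) ≤ Order.coheight p := by
  induction rs generalizing M p with
  | nil => simp
  | cons x rs ih =>
    rw [isWeaklyRegular_cons_iff] at hreg
    obtain ⟨hxp, q, hq, hpq, hxq⟩ :=
      exists_isAssociatedPrime_quotSMulTop (hmem x (by simp)) hreg.1 hp
    have h := ih (fun r hr => hmem r (by simp [hr])) hreg.2 (p := ⟨q, hq.isPrime⟩) hq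
    have hlt : p < ⟨q, hq.isPrime⟩ := lt_of_le_of_ne hpq fun h => hxp (h ▸ hxq)
    calc ((x :: rs).length : ℕ∞) = rs.length + 1 := by simp
      _ ≤ _ := add_le_add_left h 1
      _ ≤ _ := Order.coheight_add_one_le hlt

/-- If `Ext^i(κ, M) = 0` for `i < d` and `dim R / p ≤ d - g` for all primes `p ⊇ I`, then `I`
contains an `M`-regular sequence of length `g`. -/
theorem exists_isWeaklyRegular_of_coheight_add_le (I : Ideal R) (g d : ℕ)
    (hI : I ≤ maximalIdeal R) (hd : ∀ p : PrimeSpectrum R, I ≤ p.asIdeal →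
      Order.coheight p + g ≤ d) (M : ModuleCat.{u} R) [Module.Finite R M]
    (hext : ∀ i < d, Subsingleton (Ext (ModuleCat.of R (ResidueField R)) M i)) :
    ∃ rs : List R, rs.length = g ∧ (∀ r ∈ rs, r ∈ I) ∧ IsWeaklyRegular M rs := by
  induction g generalizing d M with
  | zero => exact ⟨[], by simp⟩
  | succ g ih =>
    -- Otherwise, for `M ≠ 0`, prime avoidance puts `I` inside an associated prime `p`. Vanishing of
    -- `Ext` gives a regular sequence of length `d` on `M`, so `d ≤ dim R / p`, against `dim R / p +
    -- g + 1 ≤ d`.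
    obtain ⟨x, hxI, hx⟩ : ∃ x ∈ I, IsSMulRegular M x := by
      by_contra! hcon
      rcases subsingleton_or_nontrivial M with hM | hM
      · exact hcon 0 I.zero_mem IsSMulRegular.zero
      obtain ⟨p, hp, hIp⟩ : ∃ p ∈ associatedPrimes R M, I ≤ p := by
        obtain ⟨a, ha⟩ := associatedPrimes.nonempty R M
        refine (Ideal.subset_union_prime_finite (associatedPrimes.finite R M) a a
          fun _ h _ _ => IsAssociatedPrime.isPrime h).mp ?_
        rw [biUnion_associatedPrimes_eq_compl_regular R M]
        exact fun r hr => hcon r hr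
      have hsupp : Module.support R (ResidueField R) =
          PrimeSpectrum.zeroLocus (maximalIdeal R) := by
        rw [Module.support_eq_zeroLocus]
        congr 1
        exact congrArg _ (Ideal.annihilator_quotient (I := maximalIdeal R))
      obtain ⟨rs, hlen, hmem, hreg⟩ := ModuleCat.exists_isRegular_of_exists_subsingleton_ext
        (maximalIdeal R) d M (lt_top_iff_ne_top.mpr (Submodule.top_ne_ideal_smul_of_le_jacobson_annihilator
          (IsLocalRing.maximalIdeal_le_jacobson _)).symm) (ModuleCat.of R (ResidueField R)) hsupp hext
      have h1 := length_le_coheight_of_isAssociatedPrime rs hmem hreg.toIsWeaklyRegular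
        (p := ⟨p, IsAssociatedPrime.isPrime hp⟩) hp
      have h2 := hd ⟨p, IsAssociatedPrime.isPrime hp⟩ hIp
      rw [hlen] at h1
      have h3 := (add_le_add_left h1 ((g + 1 : ℕ) : ℕ∞)).trans h2
      norm_cast at h3
      omega
    -- The hypothesis at the closed point already gives `g + 1 ≤ d`.
    have hd' : ∃ d', d = d' + 1 := by
      have := (le_add_self).trans (hd (closedPoint R) hI)
      norm_cast at this
      exact ⟨d - 1, by omega⟩
    obtain ⟨d, rfl⟩ := hd'
    obtain ⟨rs, hlen, hmem, hreg⟩ := ih d (fun p hp => by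
      have := hd p hp
      push_cast at this
      rw [← add_assoc] at this
      exact (ENat.add_le_add_iff_right ENat.one_ne_top).mp this)
      (ModuleCat.of R (QuotSMulTop x M)) (subsingleton_ext_quotSMulTop _ M hx hext)
    exact ⟨x :: rs, by simp [hlen], by simpa [hxI] using hmem,
      (isWeaklyRegular_cons_iff _ _ _).mpr ⟨hx, hreg⟩⟩

/-- In a Cohen–Macaulay local ring every proper ideal `I` contains a regular sequence of length
`ht I`. -/
theorem IsCohenMacaulayLocal.exists_isWeaklyRegular_length_eq_height (hCM : IsCohenMacaulayLocal R)
    (I : Ideal R) {g : ℕ} (hg : I.height = g) :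
    ∃ rs : List R, rs.length = g ∧ (∀ r ∈ rs, r ∈ I) ∧ IsWeaklyRegular R rs := by
  obtain ⟨rs, hmem, hreg, hdim⟩ := hCM
  have hI : I ≠ ⊤ := by
    rintro rfl
    simp at hg
  refine exists_isWeaklyRegular_of_coheight_add_le I g rs.length (le_maximalIdeal hI) ?_
    (ModuleCat.of R R) ?_
  -- Here `d = dim R`, and `ht p + dim R / p ≤ dim R` with `ht p ≥ ht I = g`.
  · intro p hp
    have h1 : (g : ℕ∞) ≤ Order.height p := by
      rw [← hg, ← PrimeSpectrum.height_eq_orderHeight]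
      exact Ideal.height_mono hp
    have h2 : ((Order.height p + Order.coheight p : ℕ∞) : WithBot ℕ∞) ≤ ringKrullDim R := by
      rw [ringKrullDim, Order.krullDim_eq_iSup_height_add_coheight_of_nonempty]
      exact WithBot.coe_le_coe.mpr (le_iSup (fun a : PrimeSpectrum R => Order.height a + Order.coheight a) p)
    rw [← hdim] at h2
    have h3 : Order.height p + Order.coheight p ≤ (rs.length : ℕ∞) := by exact_mod_cast h2
    exact ((add_comm _ _).trans_le (add_le_add_left h1 _)).trans h3
  · refine ModuleCat.subsingleton_ext_of_exists_isRegular (maximalIdeal R)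
      (ModuleCat.of R (ResidueField R)) ?_ (ModuleCat.of R R) ?_ rs hmem hreg
    · rw [Module.support_eq_zeroLocus]
      exact PrimeSpectrum.zeroLocus_anti_mono
        (Ideal.annihilator_quotient (I := maximalIdeal R)).symm.le
    · exact lt_top_iff_ne_top.mpr (Submodule.top_ne_ideal_smul_of_le_jacobson_annihilator
          (IsLocalRing.maximalIdeal_le_jacobson _)).symm

end Grade

namespace Approx

/-! ### Exactness of the total complex and at the splice -/

section Exactness

variable {R : Type u} [CommRing R] {n : ℕ}

/-- The vertical differential with values in the Koszul cycles. -/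
noncomputable def dFToCycles (f : Fin n → R) (i : ℕ) :
    MvPolynomial (Fin n) R ⊗[R] (⋀[R]^(i + 1) (Fin n → R)) →ₗ[MvPolynomial (Fin n) R]
      MvPolynomial (Fin n) R ⊗[R] cycles f i :=
  (koszulToCycles f i).baseChange (MvPolynomial (Fin n) R)

theorem dF_eq_zero_of_dFToCycles (f : Fin n → R) (i : ℕ)
    {x : MvPolynomial (Fin n) R ⊗[R] (⋀[R]^(i + 1) (Fin n → R))} (hx : dFToCycles f i x = 0) :
    dF f i x = 0 := by
  have h : dF f i =
      (cycles f i).subtype.baseChange (MvPolynomial (Fin n) R) ∘ₗ dFToCycles f i := by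
    rw [dFToCycles, ← LinearMap.baseChange_comp]
    rfl
  rw [h, LinearMap.comp_apply, hx, map_zero]

theorem dFToCycles_dF (f : Fin n → R) (i : ℕ) : dFToCycles f i ∘ₗ dF f (i + 1) = 0 :=
  baseChange_comp_zero _ _ fun x => koszulToCycles_koszulD f i x

/-- Up to sign, the augmentations of the columns form a chain map from the bottom row to `𝒵`. -/
theorem dFToCycles_dY (f : Fin n → R) (i : ℕ) :
    dFToCycles f i ∘ₗ dY R n (i + 1) + approxD f i ∘ₗ dFToCycles f (i + 1) = 0 :=
  sum_X_anticomm _ _ _ _ fun j x => koszulToCycles_contract f j i x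

variable {f : Fin n → R} {c : ℕ}

/-- The Koszul complex is exact in degrees above `c`. -/
def KoszulExactAbove (f : Fin n → R) (c : ℕ) : Prop :=
  ∀ i, c ≤ i → Function.Exact (koszulD f (i + 1)) (koszulD f i)

theorem KoszulExactAbove.dF_exact (h : KoszulExactAbove f c) {i : ℕ} (hi : c ≤ i) :
    Function.Exact (dF f (i + 1)) (dF f i) :=
  Module.Flat.lTensor_exact (MvPolynomial (Fin n) R) (h i hi)

/-- Above degree `c` every Koszul cycle is a boundary, and tensoring preserves surjections. -/
theorem KoszulExactAbove.dFToCycles_surjective (h : KoszulExactAbove f c) {i : ℕ} (hi : c ≤ i) :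
    Function.Surjective (dFToCycles f (i + 1)) := by
  refine LinearMap.lTensor_surjective (MvPolynomial (Fin n) R)
    (g := koszulToCycles f (i + 1)) fun y => ?_
  obtain ⟨x, hx⟩ := (h i hi y.1).mp y.2
  exact ⟨x, Subtype.ext hx⟩

/-- A family `x₀, …, xₘ` with `∂_f xₚ + ∂_y xₚ₊₁ = 0` and `∂_f xₘ = 0` is of the form
`xₚ = ∂_f wₚ + ∂_y wₚ₊₁`, if the columns are exact. -/
theorem exists_lift_of_columns_exact {i : ℕ} (hex : Function.Exact (dF f (i + 1)) (dF f i)) :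
    ∀ (m : ℕ) (x : Fin (m + 1) → MvPolynomial (Fin n) R ⊗[R] (⋀[R]^(i + 1) (Fin n → R))),
      (∀ p : Fin m, dF f i (x p.castSucc) + dY R n i (x p.succ) = 0) →
      dF f i (x (Fin.last m)) = 0 →
      ∃ w : Fin (m + 2) → MvPolynomial (Fin n) R ⊗[R] (⋀[R]^(i + 2) (Fin n → R)),
        ∀ p : Fin (m + 1), dF f (i + 1) (w p.castSucc) + dY R n (i + 1) (w p.succ) = x p
  | 0, x, _, hl => by
    obtain ⟨v, hv⟩ := (hex _).mp hl
    refine ⟨![v, 0], fun p => ?_⟩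
    have hp : p = Fin.last 0 := Fin.ext (by omega)
    subst hp
    exact (congrArg _ (map_zero _)).trans ((add_zero _).trans hv)
  | m + 1, x, hx, hl => by
    obtain ⟨w, hw⟩ := exists_lift_of_columns_exact hex m (fun p => x p.succ)
      (fun p => by simpa using hx p.succ) (by simpa using hl)
    -- `∂_f x₀ = -∂_y x₁ = -∂_y ∂_f w₀ = ∂_f ∂_y w₀`, where `w` lifts the tail `x₁, x₂, …` and `∂_y²
    -- = 0` removes the other term.
    have h1 : dF f i (x 0 - dY R n (i + 1) (w 0)) = 0 := by
      have h2 := LinearMap.congr_fun (dF_dY f i) (w 0)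
      have h3 := LinearMap.congr_fun (dY_dY (R := R) (n := n) i) (w 1)
      simp only [LinearMap.add_apply, LinearMap.comp_apply, LinearMap.zero_apply] at h2 h3
      have h4 : dF f (i + 1) (w 0) + dY R n (i + 1) (w 1) = x 1 := hw 0
      have h5 : dF f i (x 0) + dY R n i (x 1) = 0 := hx 0
      rw [← h4, map_add] at h5
      erw [h3] at h5
      rw [add_zero] at h5
      rw [map_sub, sub_eq_zero]
      exact (eq_neg_of_add_eq_zero_left h5).trans (eq_neg_of_add_eq_zero_left h2).symm
    obtain ⟨v, hv⟩ := (hex _).mp h1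
    refine ⟨Fin.cons v w, fun p => ?_⟩
    refine Fin.cases ?_ (fun p => ?_) p
    · rw [Fin.castSucc_zero, Fin.cons_zero, Fin.cons_succ, hv, sub_add_cancel]
    · rw [← Fin.succ_castSucc, Fin.cons_succ, Fin.cons_succ, hw p]

/-- A family as in `exists_lift_of_columns_exact`, where the last condition is only required after
the differential of the approximation complex. -/
theorem exists_lift_of_approxD_exact (h : KoszulExactAbove f c) {i : ℕ} (hi : c ≤ i)
    (hZ : Function.Exact (approxD f (i + 1)) (approxD f i)) (m : ℕ)
    (x : Fin (m + 1) → MvPolynomial (Fin n) R ⊗[R] (⋀[R]^(i + 2) (Fin n → R)))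
    (hx : ∀ p : Fin m, dF f (i + 1) (x p.castSucc) + dY R n (i + 1) (x p.succ) = 0)
    (hl : approxD f i (dFToCycles f (i + 1) (x (Fin.last m))) = 0) :
    ∃ w : Fin (m + 2) → MvPolynomial (Fin n) R ⊗[R] (⋀[R]^(i + 3) (Fin n → R)),
      ∀ p : Fin (m + 1), dF f (i + 2) (w p.castSucc) + dY R n (i + 2) (w p.succ) = x p := by
  obtain ⟨y, hy⟩ := (hZ _).mp hl
  obtain ⟨u, rfl⟩ := h.dFToCycles_surjective (hi.trans (Nat.le_succ i)) y
  have h1 := LinearMap.congr_fun (dFToCycles_dY f (i + 1)) u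
  simp only [LinearMap.add_apply, LinearMap.comp_apply, LinearMap.zero_apply] at h1
  rw [hy, ← map_add] at h1
  have h2 := LinearMap.congr_fun (dY_dY (R := R) (n := n) (i + 1)) u
  simp only [LinearMap.comp_apply, LinearMap.zero_apply] at h2
  -- Adding `∂_y u` to the last component makes it a `∂_f`-cycle and, since `∂_y² = 0`, leaves the
  -- preceding relation intact.
  obtain ⟨w, hw⟩ := exists_lift_of_columns_exact (h.dF_exact (hi.trans (Nat.le_succ i))) m
    (Function.update x (Fin.last m) (dY R n (i + 2) u + x (Fin.last m))) (fun p => by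
      rw [Function.update_of_ne (Fin.castSucc_lt_last p).ne]
      by_cases hp : p.succ = Fin.last m
      · rw [hp, Function.update_self, map_add]
        erw [h2]
        rw [zero_add, ← hp]
        exact hx p
      · rw [Function.update_of_ne hp]
        exact hx p)
    (by rw [Function.update_self]; exact dF_eq_zero_of_dFToCycles f (i + 1) h1)
  -- The last entry of `w` enters only through `∂_y`, into the last component; subtracting `u` there
  -- undoes the correction.
  refine ⟨Function.update w (Fin.last (m + 1)) (w (Fin.last (m + 1)) - u), fun p => ?_⟩
  rw [Function.update_of_ne (Fin.castSucc_lt_last p).ne]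
  by_cases hp : p = Fin.last m
  · subst hp
    have h3 := hw (Fin.last m)
    rw [Function.update_self] at h3
    rw [Fin.succ_last, Function.update_self, map_sub, add_sub, sub_eq_iff_eq_add, add_comm (x _)]
    exact h3
  · have h3 := hw p
    rw [Function.update_of_ne hp] at h3
    rw [Function.update_of_ne (fun hp' => hp (Fin.succ_injective _ (hp'.trans (Fin.succ_last m).symm)))]
    exact h3

/-- The splicing map has the same image as the differential of `𝒵` that it replaces, because `∂_f`
is onto the cycles. -/
theorem exact_spliceMap_approxD (h : KoszulExactAbove f (c + 1))
    (hZ : Function.Exact (approxD f (c + 1)) (approxD f c)) :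
    Function.Exact (spliceMap f (c + 1)) (approxD f c) := by
  refine fun z => ⟨fun hz => ?_, ?_⟩
  · obtain ⟨y, rfl⟩ := (hZ z).mp hz
    obtain ⟨u, rfl⟩ := h.dFToCycles_surjective le_rfl y
    exact ⟨fun _ => u, rfl⟩
  · rintro ⟨x, rfl⟩
    exact hZ.apply_apply_eq_zero _

/-- For a one-component family, the condition in `exists_lift_of_approxD_exact` is membership in the
kernel of the splicing map. -/
theorem exact_totalD_spliceMap (h : KoszulExactAbove f c)
    (hZ : Function.Exact (approxD f (c + 1)) (approxD f c)) :
    Function.Exact (totalD f c 0) (spliceMap f c) := by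
  refine fun x => ⟨fun hx => ?_, ?_⟩
  · obtain ⟨w, hw⟩ := exists_lift_of_approxD_exact h le_rfl hZ 0 x (fun p => p.elim0) hx
    exact ⟨w, funext hw⟩
  · rintro ⟨x, rfl⟩
    exact LinearMap.congr_fun (totalD_spliceMap f c) x

theorem exact_totalD_totalD (h : KoszulExactAbove f c)
    (hZ : ∀ i, Function.Exact (approxD f (i + 1)) (approxD f i)) (k : ℕ) :
    Function.Exact (totalD f c (k + 1)) (totalD f c k) := by
  refine fun x => ⟨fun hx => ?_, ?_⟩
  · have hx' : ∀ p : Fin (k + 1),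
        dF f (c + 2 + k) (x p.castSucc) + dY R n (c + 2 + k) (x p.succ) = 0 := fun p => congrFun hx p
    suffices ∃ w : Fin (k + 3) → MvPolynomial (Fin n) R ⊗[R] (⋀[R]^(c + 2 + k + 2) (Fin n → R)),
        ∀ p : Fin (k + 2), dF f (c + 2 + k + 1) (w p.castSucc) +
          dY R n (c + 2 + k + 1) (w p.succ) = x p from this.imp fun w hw => funext hw
    clear hx
    change Fin (k + 2) → MvPolynomial (Fin n) R ⊗[R] (⋀[R]^(c + 2 + k + 1) (Fin n → R)) at x
    -- The degree is rewritten so that the lifting lemma applies with `i = c + 1 + k`.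
    have he : c + 2 + k = c + 1 + k + 1 := by omega
    generalize c + 2 + k = e at x hx' he ⊢
    subst he
    refine exists_lift_of_approxD_exact h (by omega) (hZ _) (k + 1) x hx' ?_
    -- The augmentation kills `∂_f x_k`, so applied to the last relation it kills `∂_y x_{k+1}`; by
    -- anticommutation the image of `x_{k+1}` is a cycle of `𝒵`.
    have h1 := LinearMap.congr_fun (dFToCycles_dY f (c + 1 + k)) (x (Fin.last (k + 1)))
    have h2 := LinearMap.congr_fun (dFToCycles_dF f (c + 1 + k)) (x (Fin.last k).castSucc)
    simp only [LinearMap.add_apply, LinearMap.comp_apply, LinearMap.zero_apply] at h1 h2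
    have h3 := congrArg (dFToCycles f (c + 1 + k)) (hx' (Fin.last k))
    rw [map_add, map_zero, h2, zero_add, Fin.succ_last] at h3
    rw [h3, zero_add] at h1
    exact h1
  · rintro ⟨x, rfl⟩
    exact LinearMap.congr_fun (totalD_totalD f c k) x

end Exactness
-- Terms and differentials of a spliced complex
section Splice

variable {C : Type*} [Category C] [Limits.HasZeroMorphisms C]

/-- `S` consists of `A_i` in degrees `i ≤ c` and of `T_k` in degrees `c + 1 + k`, joined by `s`. -/
def IsSpliceOf (S A : ChainComplex C ℕ) (c : ℕ) (T : ChainComplex C ℕ) (s : T.X 0 ⟶ A.X c) :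
    Prop :=
  ∃ (z : ∀ i, i ≤ c → (S.X i ≅ A.X i)) (t : ∀ i k, i = c + 1 + k → (S.X i ≅ T.X k)),
    (∀ i (hi : i + 1 ≤ c), S.d (i + 1) i ≫ (z i (Nat.le_of_succ_le hi)).hom =
      (z (i + 1) hi).hom ≫ A.d (i + 1) i) ∧
    (∀ i (hi : i = c + 1 + 0), S.d i c ≫ (z c le_rfl).hom = (t i 0 hi).hom ≫ s) ∧
    (∀ i j k (hi : i = c + 1 + (k + 1)) (hj : j = c + 1 + k),
      S.d i j ≫ (t j k hj).hom = (t i (k + 1) hi).hom ≫ T.d (k + 1) k)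

/-- The terms of an augmented complex in positive degrees. -/
def augmentXSucc (T : ChainComplex C ℕ) {X : C} (s : T.X 0 ⟶ X) (h : T.d 1 0 ≫ s = 0) (k : ℕ) :
    (ChainComplex.augment T s h).X (k + 1) ≅ T.X k := Iso.refl _

/-- The term of an augmented complex in degree `0`. -/
def augmentXZero (T : ChainComplex C ℕ) {X : C} (s : T.X 0 ⟶ X) (h : T.d 1 0 ≫ s = 0) :
    (ChainComplex.augment T s h).X 0 ≅ X := Iso.refl _

theorem augment_d_augmentXSucc (T : ChainComplex C ℕ) {X : C} (s : T.X 0 ⟶ X)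
    (h : T.d 1 0 ≫ s = 0) (k : ℕ) :
    (ChainComplex.augment T s h).d (k + 2) (k + 1) ≫ (augmentXSucc T s h k).hom =
      (augmentXSucc T s h (k + 1)).hom ≫ T.d (k + 1) k :=
  (Category.comp_id _).trans (Category.id_comp _).symm

theorem augment_d_augmentXZero (T : ChainComplex C ℕ) {X : C} (s : T.X 0 ⟶ X)
    (h : T.d 1 0 ≫ s = 0) :
    (ChainComplex.augment T s h).d 1 0 ≫ (augmentXZero T s h).hom =
      (augmentXSucc T s h 0).hom ≫ s :=
  (Category.comp_id _).trans (Category.id_comp _).symm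

theorem isSpliceOf_augment (A T : ChainComplex C ℕ) (s : T.X 0 ⟶ A.X 0) (h : T.d 1 0 ≫ s = 0) :
    IsSpliceOf (ChainComplex.augment T s h) A 0 T s := by
  refine ⟨fun i hi => (ChainComplex.augment T s h).XIsoOfEq (Nat.le_zero.mp hi) ≪≫
      augmentXZero T s h ≪≫ A.XIsoOfEq (Nat.le_zero.mp hi).symm,
    fun i k hi => (ChainComplex.augment T s h).XIsoOfEq (show i = k + 1 by omega) ≪≫
      augmentXSucc T s h k, fun i hi => by omega, ?_, ?_⟩
  · intro i hi
    obtain rfl : i = 1 := hi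
    simp only [Iso.trans_hom, HomologicalComplex.XIsoOfEq_rfl, Iso.refl_hom, Category.id_comp,
      Category.comp_id]
    exact augment_d_augmentXZero T s h
  · intro i j k hi hj
    obtain rfl : i = k + 1 + 1 := by omega
    obtain rfl : j = k + 1 := by omega
    simp only [Iso.trans_hom, HomologicalComplex.XIsoOfEq_rfl, Iso.refl_hom, Category.id_comp]
    exact augment_d_augmentXSucc T s h k

/-- The bottom term of the augmented complex is `A_{c+1}`; reassigning it from the upper part to the
lower part mirrors one recursion step of `splice`. -/
theorem IsSpliceOf.of_augment {S A T : ChainComplex C ℕ} {c : ℕ} {s : T.X 0 ⟶ A.X (c + 1)}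
    {h : T.d 1 0 ≫ s = 0}
    (H : IsSpliceOf S A c (ChainComplex.augment T s h) (A.d (c + 1) c)) :
    IsSpliceOf S A (c + 1) T s := by
  obtain ⟨z, t, hz, hs, ht⟩ := H
  have e : ∀ i, i ≤ c + 1 → ¬ i ≤ c → i = c + 1 := fun i h1 h2 => by omega
  refine ⟨fun i hi => if hc : i ≤ c then z i hc else
      t i 0 (e i hi hc) ≪≫ augmentXZero T s h ≪≫ A.XIsoOfEq (e i hi hc).symm,
    fun i k hi => t i (k + 1) (by omega) ≪≫ augmentXSucc T s h k, ?_, ?_, ?_⟩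
  · intro i hi
    by_cases hc : i + 1 ≤ c
    · simp only [dif_pos hc, dif_pos (Nat.le_of_succ_le hc)]
      exact hz i hc
    · obtain rfl : i = c := by omega
      simp only [dif_neg hc, dif_pos le_rfl, Iso.trans_hom, Category.assoc,
        HomologicalComplex.XIsoOfEq_hom_comp_d]
      exact (hs _ rfl).trans (congrArg _ (Category.id_comp _).symm)
  · intro i hi
    simp only [dif_neg (Nat.not_succ_le_self c), Iso.trans_hom, Category.assoc]
    have := ht i (c + 1) 0 hi rfl
    simp only [HomologicalComplex.XIsoOfEq_rfl, Iso.refl_hom, Category.comp_id]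
    rw [← augment_d_augmentXZero T s h]
    exact (reassoc_of% this) _
  · intro i j k hi hj
    have := ht i j (k + 1) (by omega) (by omega)
    simp only [Iso.trans_hom, Category.assoc, ← augment_d_augmentXSucc T s h k]
    exact (reassoc_of% this) _

theorem isSpliceOf_splice (A : ChainComplex C ℕ) (c : ℕ) (T : ChainComplex C ℕ)
    (s : T.X 0 ⟶ A.X c) (h : T.d 1 0 ≫ s = 0) (h' : ∀ j, s ≫ A.d c j = 0) :
    IsSpliceOf (splice A c T s h h') A c T s := by
  induction c generalizing T with
  | zero => exact isSpliceOf_augment A T s h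
  | succ c ih => exact IsSpliceOf.of_augment (h := h) (ih _ _ _ _)

end Splice

/-! ### Exactness of module complexes through isomorphic terms -/

section ModuleComplex

variable {S : Type*} [Ring S]

theorem exactAt_succ_iff_of_iso {K : ChainComplex (ModuleCat.{u} S) ℕ} {i : ℕ}
    {X₂ X₁ X₀ : ModuleCat.{u} S} (e₂ : K.X (i + 2) ≅ X₂) (e₁ : K.X (i + 1) ≅ X₁) (e₀ : K.X i ≅ X₀)
    (a : X₂ ⟶ X₁) (b : X₁ ⟶ X₀) (ha : K.d (i + 2) (i + 1) ≫ e₁.hom = e₂.hom ≫ a)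
    (hb : K.d (i + 1) i ≫ e₀.hom = e₁.hom ≫ b) :
    K.ExactAt (i + 1) ↔ Function.Exact a.hom b.hom := by
  have hab : a ≫ b = 0 := by
    rw [← cancel_epi e₂.hom, ← Category.assoc, ← ha, Category.assoc, ← hb, ← Category.assoc,
      K.d_comp_d, Limits.zero_comp, Limits.comp_zero]
  rw [K.exactAt_iff' (i + 2) (i + 1) i (by simp) (by simp),
    ShortComplex.exact_iff_of_iso (S₂ := ShortComplex.mk a b hab)
      (ShortComplex.isoMk e₂ e₁ e₀ ha.symm hb.symm),
    ShortComplex.ShortExact.moduleCat_exact_iff_function_exact]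

end ModuleComplex

/-! ### Homogeneity of the differentials -/

section Homogeneity

variable {R : Type u} [CommRing R] {n : ℕ}

theorem baseChange_mem_twistPart {M N : Type*} [AddCommGroup M] [Module R M] [AddCommGroup N]
    [Module R N] (φ : M →ₗ[R] N) {a ν : ℕ} {x : MvPolynomial (Fin n) R ⊗[R] M}
    (hx : x ∈ twistPart n M a ν) :
    φ.baseChange (MvPolynomial (Fin n) R) x ∈ twistPart n N a ν := by
  induction hx using Submodule.span_induction with
  | mem x hx =>
    obtain ⟨e, b, m, he, hb, rfl⟩ := hx
    exact Submodule.subset_span ⟨e, b, φ m, he, hb, LinearMap.baseChange_tmul _ _ _⟩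
  | zero => rw [map_zero]; exact Submodule.zero_mem _
  | add x y _ _ hx hy => rw [map_add]; exact Submodule.add_mem _ hx hy
  | smul r x _ hx => rw [LinearMap.map_smul_of_tower]; exact Submodule.smul_mem _ _ hx

/-- A variable raises the polynomial degree by one, which offsets lowering the twist by one. -/
theorem X_smul_mem_twistPart {M : Type*} [AddCommGroup M] [Module R M] (j : Fin n) {a ν : ℕ}
    {x : MvPolynomial (Fin n) R ⊗[R] M} (hx : x ∈ twistPart n M (a + 1) ν) :
    (MvPolynomial.X j : MvPolynomial (Fin n) R) • x ∈ twistPart n M a ν := by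
  induction hx using Submodule.span_induction with
  | mem x hx =>
    obtain ⟨e, b, m, he, hb, rfl⟩ := hx
    refine Submodule.subset_span ⟨1 + e, MvPolynomial.X j * b, m, by omega,
      (MvPolynomial.isHomogeneous_X R j).mul hb, ?_⟩
    rw [TensorProduct.smul_tmul', smul_eq_mul]
  | zero => rw [smul_zero]; exact Submodule.zero_mem _
  | add x y _ _ hx hy => rw [smul_add]; exact Submodule.add_mem _ hx hy
  | smul r x _ hx => rw [smul_comm]; exact Submodule.smul_mem _ _ hx

theorem sum_X_baseChange_mem_twistPart {M N : Type*} [AddCommGroup M] [Module R M]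
    [AddCommGroup N] [Module R N] (φ : Fin n → M →ₗ[R] N) {a ν : ℕ}
    {x : MvPolynomial (Fin n) R ⊗[R] M} (hx : x ∈ twistPart n M (a + 1) ν) :
    (∑ j, (MvPolynomial.X j : MvPolynomial (Fin n) R) •
      (φ j).baseChange (MvPolynomial (Fin n) R)) x ∈ twistPart n N a ν := by
  rw [LinearMap.sum_apply]
  exact Submodule.sum_mem _ fun j _ => X_smul_mem_twistPart j (baseChange_mem_twistPart (φ j) hx)

theorem sum_X_baseChange_mem_twistPart_submodule {M N : Type*} [AddCommGroup M] [Module R M]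
    [AddCommGroup N] [Module R N] {P : Submodule R M} {Q : Submodule R N}
    (φ : Fin n → P →ₗ[R] Q) {a ν : ℕ} {x : MvPolynomial (Fin n) R ⊗[R] P}
    (hx : x ∈ twistPart n P (a + 1) ν) :
    (∑ j, (MvPolynomial.X j : MvPolynomial (Fin n) R) •
      (φ j).baseChange (MvPolynomial (Fin n) R)) x ∈ twistPart n Q a ν :=
  sum_X_baseChange_mem_twistPart _ hx

theorem approxD_mem_twistPart (f : Fin n → R) (i : ℕ) {a ν : ℕ}
    {x : MvPolynomial (Fin n) R ⊗[R] cycles f (i + 1)}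
    (hx : x ∈ twistPart n (cycles f (i + 1)) (a + 1) ν) :
    approxD f i x ∈ twistPart n (cycles f i) a ν :=
  sum_X_baseChange_mem_twistPart_submodule (fun j => cyclesContract f j i) hx

/-- Component `p` receives `∂_f` from column `p`, with equal twist, and `∂_y` from column `p + 1`,
whose twist is larger by one. -/
theorem totalD_mem_twistPart (f : Fin n → R) (c k : ℕ) {a ν : ℕ}
    {x : Fin (k + 2) → MvPolynomial (Fin n) R ⊗[R] (⋀[R]^(c + 2 + (k + 1)) (Fin n → R))}
    (hx : ∀ p : Fin (k + 2),
      x p ∈ twistPart n (⋀[R]^(c + 2 + (k + 1)) (Fin n → R)) (a + p) ν) (p : Fin (k + 1)) :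
    totalD f c k x p ∈ twistPart n (⋀[R]^(c + 2 + k) (Fin n → R)) (a + p) ν :=
  Submodule.add_mem _ (baseChange_mem_twistPart _ (hx p.castSucc))
    (sum_X_baseChange_mem_twistPart _ (hx p.succ))

theorem spliceMap_mem_twistPart (f : Fin n → R) (c : ℕ) {a ν : ℕ}
    {x : Fin 1 → MvPolynomial (Fin n) R ⊗[R] (⋀[R]^(c + 2) (Fin n → R))}
    (hx : x 0 ∈ twistPart n (⋀[R]^(c + 2) (Fin n → R)) (a + 1) ν) :
    spliceMap f c x ∈ twistPart n (cycles f c) a ν :=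
  approxD_mem_twistPart f c (baseChange_mem_twistPart _ hx)

end Homogeneity

/-! ### Assembly: acyclicity and the main theorem -/

section Main

variable {R : Type u} [CommRing R] {n : ℕ}

theorem approxComplex_exactAt_succ_iff (f : Fin n → R) (i : ℕ) :
    (approxComplex f).ExactAt (i + 1) ↔ Function.Exact (approxD f (i + 1)) (approxD f i) :=
  exactAt_succ_iff_of_iso (Iso.refl _) (Iso.refl _) (Iso.refl _) (ModuleCat.ofHom (approxD f (i + 1)))
    (ModuleCat.ofHom (approxD f i))
    ((Category.comp_id _).trans ((approxComplex_d f (i + 1)).trans (Category.id_comp _).symm))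
    ((Category.comp_id _).trans ((approxComplex_d f i).trans (Category.id_comp _).symm))

theorem totalComplex_X_free (f : Fin n → R) (c k : ℕ) :
    Module.Free (MvPolynomial (Fin n) R) ((totalComplex f c).X k) :=
  inferInstanceAs (Module.Free (MvPolynomial (Fin n) R)
    (Fin (k + 1) → MvPolynomial (Fin n) R ⊗[R] (⋀[R]^(c + 2 + k) (Fin n → R))))

theorem totalComplex_X_finite (f : Fin n → R) (c k : ℕ) :
    Module.Finite (MvPolynomial (Fin n) R) ((totalComplex f c).X k) :=
  inferInstanceAs (Module.Finite (MvPolynomial (Fin n) R)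
    (Fin (k + 1) → MvPolynomial (Fin n) R ⊗[R] (⋀[R]^(c + 2 + k) (Fin n → R))))

theorem isZero_totalComplex_X [Nontrivial R] (f : Fin n → R) {c k : ℕ} (h : n < c + 2 + k) :
    Limits.IsZero ((totalComplex f c).X k) := by
  have := exteriorPower_subsingleton (R := R) h
  have hs : Subsingleton (Fin (k + 1) →
      MvPolynomial (Fin n) R ⊗[R] (⋀[R]^(c + 2 + k) (Fin n → R))) := inferInstance
  exact @ModuleCat.isZero_of_subsingleton _ _ ((totalComplex f c).X k) hs

/-- If the Koszul complex is exact in degrees above `c` and the approximation complex is acyclic,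
then every complex spliced from `𝔗` and the truncated approximation complex is acyclic. -/
theorem IsSpliceOf.exactAt {f : Fin n → R} {c : ℕ}
    {S : ChainComplex (ModuleCat.{u} (MvPolynomial (Fin n) R)) ℕ}
    (hS : IsSpliceOf S (approxComplex f) c (totalComplex f c) (connect f c))
    (hK : KoszulExactAbove f c) (hZ : ∀ i, 0 < i → (approxComplex f).ExactAt i) {i : ℕ}
    (hi : 0 < i) : S.ExactAt i := by
  obtain ⟨z, t, hz, hs, ht⟩ := hS
  have hZ' : ∀ i, Function.Exact (approxD f (i + 1)) (approxD f i) := fun i =>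
    (approxComplex_exactAt_succ_iff f i).mp (hZ (i + 1) i.succ_pos)
  obtain ⟨i, rfl⟩ : ∃ j, i = j + 1 := ⟨i - 1, by omega⟩
  -- Below `c` only `𝒵` is involved; at `c` the incoming map is the splice; above `c` the term is
  -- `𝔗_k` with `i = c + k`, and for `k = 0` the outgoing map is the splice.
  rcases lt_trichotomy (i + 1) c with hlt | rfl | hlt
  · refine (exactAt_succ_iff_of_iso (z (i + 2) hlt) (z (i + 1) hlt.le) (z i (by omega)) _ _
      (hz (i + 1) hlt) (hz i hlt.le)).mpr ?_
    rw [approxComplex_d, approxComplex_d]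
    exact hZ' i
  · refine (exactAt_succ_iff_of_iso (t (i + 2) 0 rfl) (z (i + 1) le_rfl) (z i (by omega)) _ _
      (hs (i + 2) rfl) (hz i le_rfl)).mpr ?_
    rw [approxComplex_d]
    exact exact_spliceMap_approxD hK (hZ' i)
  · obtain ⟨k, rfl⟩ := Nat.exists_eq_add_of_le (Nat.le_of_lt_succ hlt)
    cases k with
    | zero =>
      refine (exactAt_succ_iff_of_iso (t (c + 2) 1 rfl) (t (c + 1) 0 rfl) (z c le_rfl) _ _
        (ht _ _ 0 rfl rfl) (hs (c + 1) rfl)).mpr ?_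
      rw [totalComplex_d]
      exact exact_totalD_spliceMap hK (hZ' c)
    | succ k =>
      refine (exactAt_succ_iff_of_iso (t (c + (k + 1) + 2) (k + 2) (by omega))
        (t (c + (k + 1) + 1) (k + 1) (by omega)) (t (c + (k + 1)) k (by omega)) _ _
        (ht _ _ (k + 1) _ _) (ht _ _ k _ _)).mpr ?_
      rw [totalComplex_d, totalComplex_d]
      exact exact_totalD_totalD hK hZ' k

/-- Over a Cohen–Macaulay local ring the Koszul complex of `f₁, …, fₙ` is exact in degrees above
`n - ht (f₁, …, fₙ)`. -/
theorem koszulExactAbove_of_isCohenMacaulayLocal [IsNoetherianRing R] [IsLocalRing R]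
    (hCM : IsCohenMacaulayLocal R) {g : ℕ} (f : Fin n → R)
    (hht : (Ideal.span (Set.range f)).height = g) : KoszulExactAbove f (n - g) := by
  obtain ⟨rs, hlen, hmem, hreg⟩ := hCM.exists_isWeaklyRegular_length_eq_height _ hht
  intro i hi
  -- Taken with coefficients `M = R`; the isomorphisms `R ⊗ ∧ᵏ ≃ ∧ᵏ` then remove the tensor factor.
  have h := lTensor_koszulD_exact f rs hmem hreg (i := i) (by omega)
  have hnat : ∀ k (y : R ⊗[R] ⋀[R]^(k + 1) (Fin n → R)),
      TensorProduct.lid R _ ((koszulD f k).lTensor R y) =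
        koszulD f k (TensorProduct.lid R _ y) := fun k y => by
    induction y with
    | zero => simp
    | add x y hx hy => simp only [map_add, hx, hy]
    | tmul r m => simp
  exact (Function.Exact.iff_of_ladder_linearEquiv (e₁ := TensorProduct.lid R _)
    (e₂ := TensorProduct.lid R _) (e₃ := TensorProduct.lid R _)
    (LinearMap.ext fun y => (hnat _ y).symm) (LinearMap.ext fun y => (hnat _ y).symm)).mpr h

end Main

end Approx

theorem mainTheorem9 {R : Type u} [CommRing R] [IsNoetherianRing R] [IsLocalRing R]
    (hCM : IsCohenMacaulayLocal R) {n g : ℕ} (f : Fin n → R)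
    (hmin : (Ideal.span (Set.range f)).spanFinrank = n)
    (hht : (Ideal.span (Set.range f)).height = g) (hg : 1 ≤ g) :
    -- the spliced complex consists of `𝒵_i` for `i ≤ n - g` and of `𝔗_k` in degree `n - g + 1 + k`
    (∃ (z : ∀ i, i ≤ n - g →
          ((Approx.splicedComplex f (n - g)).X i ≅ (Approx.approxComplex f).X i))
        (t : ∀ k, ((Approx.splicedComplex f (n - g)).X (n - g + 1 + k) ≅
          (Approx.totalComplex f (n - g)).X k)),
        (∀ i (hi : i + 1 ≤ n - g),
          (Approx.splicedComplex f (n - g)).d (i + 1) i ≫ (z i (Nat.le_of_succ_le hi)).hom =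
            (z (i + 1) hi).hom ≫ (Approx.approxComplex f).d (i + 1) i) ∧
        ((Approx.splicedComplex f (n - g)).d (n - g + 1) (n - g) ≫ (z (n - g) le_rfl).hom =
          (t 0).hom ≫ Approx.connect f (n - g)) ∧
        (∀ k, (Approx.splicedComplex f (n - g)).d (n - g + 1 + (k + 1)) (n - g + 1 + k) ≫
            (t k).hom =
          (t (k + 1)).hom ≫ (Approx.totalComplex f (n - g)).d (k + 1) k)) ∧
    -- all differentials are homogeneous of degree `0` for the twists `𝒵_i = Z_i ⊗ B(-i)` and
    -- `𝔇_{p,q} = ∧^{n-g+2+p+q} Rⁿ ⊗ B(-(n-g+1+p))`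
    (∀ i ν, ∀ x ∈ Approx.twistPart n (Approx.cycles f (i + 1)) (i + 1) ν,
      Approx.approxD f i x ∈ Approx.twistPart n (Approx.cycles f i) i ν) ∧
    (∀ k ν x, (∀ p : Fin (k + 2), x p ∈ Approx.twistPart n
          (⋀[R]^(n - g + 2 + (k + 1)) (Fin n → R)) (n - g + 1 + p) ν) →
      ∀ p : Fin (k + 1), Approx.totalD f (n - g) k x p ∈ Approx.twistPart n
          (⋀[R]^(n - g + 2 + k) (Fin n → R)) (n - g + 1 + p) ν) ∧
    (∀ ν x, x 0 ∈ Approx.twistPart n (⋀[R]^(n - g + 2) (Fin n → R)) (n - g + 1) ν →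
      Approx.spliceMap f (n - g) x ∈ Approx.twistPart n (Approx.cycles f (n - g)) (n - g) ν) ∧
    -- the last `g - 1` modules are free of finite rank, and there is nothing beyond them
    (∀ i, n - g < i →
      Module.Free (MvPolynomial (Fin n) R) ((Approx.splicedComplex f (n - g)).X i) ∧
      Module.Finite (MvPolynomial (Fin n) R) ((Approx.splicedComplex f (n - g)).X i)) ∧
    (∀ i, n ≤ i → Limits.IsZero ((Approx.splicedComplex f (n - g)).X i)) ∧
    -- acyclicity
    ((∀ i, 0 < i → (Approx.approxComplex f).ExactAt i) →
      ∀ i, 0 < i → (Approx.splicedComplex f (n - g)).ExactAt i) := by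

  -- Krull's height theorem, with `n` the minimal number of generators; it makes `n - g` a genuine
  -- difference.
  have hgn : g ≤ n := by
    have hI : Ideal.span (Set.range f) ≠ ⊤ := fun h => by simp [h] at hht
    have h := Ideal.height_le_spanFinrank _ hI
    rw [hht, hmin] at h
    exact_mod_cast h
  have hS := Approx.isSpliceOf_splice (Approx.approxComplex f) (n - g)
    (Approx.totalComplex f (n - g)) (Approx.connect f (n - g)) (Approx.d_connect f (n - g))
    (Approx.connect_d f (n - g))
  have hacyc := fun hZ i hi => Approx.IsSpliceOf.exactAt hS (i := i)
    (Approx.koszulExactAbove_of_isCohenMacaulayLocal hCM f hht) hZ hi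
  obtain ⟨z, t, hz, hs, ht⟩ := hS
  refine ⟨⟨z, fun k => t _ k rfl, hz, hs _ rfl, fun k => ht _ _ k rfl rfl⟩,
    fun i ν x hx => Approx.approxD_mem_twistPart f i hx,
    fun k ν x hx p => Approx.totalD_mem_twistPart f (n - g) k hx p,
    fun ν x hx => Approx.spliceMap_mem_twistPart f (n - g) hx, fun i hi => ?_, fun i hi => ?_,
    hacyc⟩
  · obtain ⟨k, rfl⟩ := Nat.exists_eq_add_of_le (Nat.succ_le_of_lt hi)
    have e := (t _ k rfl).toLinearEquiv
    have := Approx.totalComplex_X_free f (n - g) k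
    have := Approx.totalComplex_X_finite f (n - g) k
    exact ⟨Module.Free.of_equiv e.symm, Module.Finite.equiv e.symm⟩
  -- Since `1 ≤ g ≤ n`, a degree `i ≥ n` lies in the `𝔗` part, and `n ≤ n - g + 1 + k` puts the
  -- exterior degree `n - g + 2 + k` above `n`.
  · obtain ⟨k, rfl⟩ := Nat.exists_eq_add_of_le (show n - g + 1 ≤ i by omega)
    exact (Approx.isZero_totalComplex_X f (by omega)).of_iso (t _ k rfl)
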